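/- Let the odd-distance graph be the graph with vertex set $\mathbb{R}^2$ in which two points are adjacent exactly when their Euclidean distance is an odd integer. Define the measurable chromatic number of a graph on $\mathbb{R}^2$ to be the least number $n$ of colors in a proper coloring of the graph all of whose color classes are Lebesgue measurable, and $\infty$ if no finite number of colors suffices. Then the measurable chromatic number of the odd-distance graph is infinite; that is, the odd-distance graph has no proper coloring with finitely many colors in which every color class is Lebesgue measurable. -/

import Mathlib

open MeasureTheory

/-- The odd-distance graph: the vertices are the points of the Euclidean plane, and two points are
adjacent when their Euclidean distance is an odd integer. -/
def oddDistanceGraph : SimpleGraph (EuclideanSpace ℝ (Fin 2)) where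
  Adj x y := ∃ m : ℤ, Odd m ∧ dist x y = (m : ℝ)
  symm := ⟨by
    rintro x y ⟨m, hm, h⟩
    exact ⟨m, hm, by rw [dist_comm, h]⟩⟩
  loopless := ⟨by
    rintro x ⟨m, hm, h⟩
    rw [dist_self] at h
    have h0 : m = 0 := by exact_mod_cast h.symm
    subst h0
    exact absurd hm (by decide)⟩

/-- A graph on a measure space is measurably `n`-colorable if it has a proper coloring with `n`
colors all of whose color classes are measurable with respect to the completion of `μ`
(for `μ` the volume of a Euclidean space: Lebesgue measurable). -/
def MeasurablyColorable {V : Type*} [MeasurableSpace V] (μ : Measure V) (G : SimpleGraph V)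
    (n : ℕ) : Prop :=
  ∃ C : G.Coloring (Fin n), ∀ c : Fin n, NullMeasurableSet (C.colorClass c) μ

/-- The measurable chromatic number: the least number of colors in a proper coloring with
measurable color classes, and `⊤` if no finite number of colors suffices. -/
noncomputable def measurableChromaticNumber {V : Type*} [MeasurableSpace V] (μ : Measure V)
    (G : SimpleGraph V) : ℕ∞ :=
  ⨅ n ∈ {n : ℕ | MeasurablyColorable μ G n}, (n : ℕ∞)

/-!
Suppose the plane is covered by `n` measurable sets none of which contains two points at odd
distance. One of them, cut down to a large ball, gives a set `S` occupying a definite proportion of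
this ball. Let `φ z` be the measure of `S ∩ (S - z)`; this is the inner product in `L²` of two
translates of the indicator function of `S`, and it vanishes when `|z|` is odd.

Choose odd radii `k 0, k 1, …` growing fast, and let `v j` be the average of the indicator function
of `S` over translations by `k j • u`, where `u` is a random point of an arc of the unit circle. For
`j < l` the inner product `⟪v j, v l⟫` is an average of `φ (k l • w - k j • u)`. Since `k j` is much
smaller than `k l`, dropping `k j • u` hardly changes this average
(`abs_integral_corr_translate_le`), and then it is an average of values `φ (k l • w) = 0`. So the
`v j` are almost orthogonal. On the other hand each has integral `μ S` and is supported in the ball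
of twice the radius, so all have a large inner product with the indicator function of that ball; for
many radii this contradicts the Cauchy--Schwarz inequality
(`sq_card_mul_le_of_corr_eq_zero`, `exists_odd_not_ae_disjoint_translate`).

A short translation matters little because, although arc measure is singular, the difference of two
independent random points of the arc has a density (`map_sub_arcMeasure_absolutelyContinuous`), and
densities move continuously in `L¹` under translation
(`exists_abs_integral_translate_sub_le`). A Cauchy--Schwarz step reduces the average over the arc to
one over these differences.
-/

/-! ### Translation of absolutely continuous measures -/

section Correlation

variable {E : Type*} [NormedAddCommGroup E] [NormedSpace ℝ E] [FiniteDimensional ℝ E]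
  [MeasurableSpace E] [BorelSpace E]

/-- Small translations change an absolutely continuous finite measure little in total variation:
its density is moved continuously in `L¹`. The total variation is expressed by testing against
bounded continuous functions. -/
theorem exists_abs_integral_translate_sub_le (μ : Measure E) [μ.IsAddHaarMeasure]
    (η : Measure E) [IsFiniteMeasure η] (hη : η ≪ μ) {ε : ℝ} (hε : 0 < ε) :
    ∃ δ > 0, ∀ q : E, ‖q‖ ≤ δ → ∀ φ : E → ℝ, Continuous φ → ∀ C : ℝ, (∀ z, |φ z| ≤ C) →
      |∫ z, φ (z + q) ∂η - ∫ z, φ z ∂η| ≤ C * ε := by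
  set h : E → ℝ := fun z => (η.rnDeriv μ z).toReal
  have hint : Integrable h μ := Measure.integrable_toReal_rnDeriv
  have hmp : ∀ y : E, MeasurePreserving (fun z => z + y) μ μ := fun y =>
    measurePreserving_add_right μ y
  let F : Lp ℝ 1 μ := hint.toL1 h
  have hcont : Continuous fun y : E => Lp.compMeasurePreserving (fun z => z + y) (hmp y) F := by
    let g : E → C(E, E) := fun y => ⟨fun z => z + y, by fun_prop⟩
    have hg : Continuous g := ContinuousMap.continuous_of_continuous_uncurry _ (by
      show Continuous fun p : E × E => p.2 + p.1
      fun_prop)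
    exact Continuous.compMeasurePreservingLp (f := fun _ : E => F) (g := g) continuous_const hg
      hmp (by simp)
  have h0 : Lp.compMeasurePreserving (fun z => z + (0 : E)) (hmp 0) F = F := by
    apply Lp.ext
    filter_upwards [Lp.coeFn_compMeasurePreserving F (hmp 0)] with z hz
    rw [hz]; simp
  obtain ⟨δ, hδ, hball⟩ := Metric.continuousAt_iff.1 (hcont.continuousAt (x := 0)) ε hε
  refine ⟨δ / 2, by positivity, fun q hq φ hφ C hC => ?_⟩
  have hq' : dist (-q) 0 < δ := by
    rw [dist_zero_right, norm_neg]; linarith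
  have hd := hball hq'
  rw [h0, dist_eq_norm] at hd
  have hnorm : ‖Lp.compMeasurePreserving (fun z => z + -q) (hmp (-q)) F - F‖
      = ∫ z, |h (z + -q) - h z| ∂μ := by
    rw [L1.norm_eq_integral_norm]
    apply integral_congr_ae
    have hF := hint.coeFn_toL1
    filter_upwards [Lp.coeFn_sub (Lp.compMeasurePreserving (fun z => z + -q) (hmp (-q)) F) F,
      Lp.coeFn_compMeasurePreserving F (hmp (-q)), hF,
      (hmp (-q)).quasiMeasurePreserving.ae hF] with z h1 h2 h3 h4
    rw [h1, Pi.sub_apply, h2, Function.comp_apply, h3, h4, Real.norm_eq_abs]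
  rw [hnorm] at hd
  have hI : Integrable (fun z => h (z + -q)) μ := (hmp (-q)).integrable_comp_of_integrable hint
  have hbd : ∀ {g : E → ℝ}, Integrable g μ → Integrable (fun z => g z * φ z) μ := fun hg =>
    hg.mul_bdd hφ.aestronglyMeasurable (Filter.Eventually.of_forall hC)
  have e1 : ∫ z, φ z ∂η = ∫ z, h z * φ z ∂μ := (integral_rnDeriv_smul hη).symm
  have e2 : ∫ z, φ (z + q) ∂η = ∫ z, h (z + -q) * φ z ∂μ := by
    rw [← integral_rnDeriv_smul hη,
      ← integral_add_right_eq_self (fun z => h (z + -q) * φ z) q]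
    simp [h]
  rw [e1, e2, ← integral_sub (hbd hI) (hbd hint)]
  calc |∫ z, (h (z + -q) * φ z - h z * φ z) ∂μ|
      ≤ ∫ z, |h (z + -q) * φ z - h z * φ z| ∂μ := abs_integral_le_integral_abs
    _ ≤ ∫ z, C * |h (z + -q) - h z| ∂μ := by
        refine integral_mono ((hbd hI).sub (hbd hint)).abs ((hI.sub hint).abs.const_mul C)
          fun z => ?_
        simp only
        rw [← sub_mul, abs_mul, mul_comm]
        exact mul_le_mul_of_nonneg_right (hC z) (abs_nonneg _)
    _ = C * ∫ z, |h (z + -q) - h z| ∂μ := integral_const_mul _ _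
    _ ≤ C * ε := mul_le_mul_of_nonneg_left hd.le ((abs_nonneg _).trans (hC 0))

end Correlation

/-! ### Correlations of a stationary family of vectors -/

section Hilbert

open scoped RealInnerProductSpace

variable {E : Type*} [NormedAddCommGroup E]
  {H : Type*} [NormedAddCommGroup H] [InnerProductSpace ℝ H] {x : E → H} {φ : E → ℝ}

theorem abs_corr_le (hφ : ∀ y z, ⟪x y, x z⟫ = φ (z - y)) (z : E) : |φ z| ≤ φ 0 := by
  have hn : ∀ y, ‖x y‖ * ‖x y‖ = φ 0 := fun y => by
    rw [← real_inner_self_eq_norm_mul_norm, hφ, sub_self]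
  have h1 := abs_real_inner_le_norm (x 0) (x z)
  rw [hφ, sub_zero] at h1
  nlinarith [hn 0, hn z, sq_nonneg (‖x 0‖ - ‖x z‖)]

theorem continuous_corr (hx : Continuous x) (hφ : ∀ y z, ⟪x y, x z⟫ = φ (z - y)) :
    Continuous φ := by
  have : φ = fun z => ⟪x 0, x z⟫ := by ext z; rw [hφ, sub_zero]
  rw [this]; fun_prop

theorem corr_neg (hφ : ∀ y z, ⟪x y, x z⟫ = φ (z - y)) (z : E) : φ (-z) = φ z := by
  have h1 := hφ 0 z
  have h2 := hφ z 0
  rw [real_inner_comm] at h2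
  rw [← sub_zero z, ← h1, h2]; simp

theorem norm_eq_sqrt_corr (hφ : ∀ y z, ⟪x y, x z⟫ = φ (z - y)) (y : E) : ‖x y‖ = √(φ 0) := by
  rw [← sub_self y, ← hφ, real_inner_self_eq_norm_mul_norm, Real.sqrt_mul_self (norm_nonneg _)]

variable [NormedSpace ℝ E] [FiniteDimensional ℝ E] [MeasurableSpace E] [BorelSpace E]

theorem integrable_orbit (hx : Continuous x) (hφ : ∀ y z, ⟪x y, x z⟫ = φ (z - y))
    (ν : Measure E) [IsFiniteMeasure ν] {f : E → E} (hf : Continuous f) :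
    Integrable (fun w => x (f w)) ν := by
  exact Integrable.of_bound (hx.comp hf).aestronglyMeasurable (√(φ 0))
    (Filter.Eventually.of_forall fun w => (norm_eq_sqrt_corr hφ _).le)

/-- The average of the correlation function over a large copy `k • ν` of `ν` is almost unchanged by
a translation `p` that is short compared with `k`. The average is a scalar product with
`G = ∫ (x (p - k • w) - x (-k • w)) dν`, and the norm of `G` only involves the law `η` of the
difference of two `ν`-random points, whose translates are close in total variation. -/
theorem abs_integral_corr_translate_le [CompleteSpace H] (hx : Continuous x)
    (hφ : ∀ y z, ⟪x y, x z⟫ = φ (z - y)) (ν : Measure E) [IsProbabilityMeasure ν] {ε δ : ℝ}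
    (hδ : ∀ q : E, ‖q‖ ≤ δ → ∀ ψ : E → ℝ, Continuous ψ → ∀ C : ℝ, (∀ z, |ψ z| ≤ C) →
      |∫ z, ψ (z + q) ∂((ν.prod ν).map fun w => w.1 - w.2)
        - ∫ z, ψ z ∂((ν.prod ν).map fun w => w.1 - w.2)| ≤ C * ε)
    {k : ℝ} (hk : 0 < k) {p : E} (hp : ‖p‖ ≤ δ * k) :
    |∫ w, φ (k • w - p) ∂ν - ∫ w, φ (k • w) ∂ν| ≤ φ 0 * √(2 * ε) := by
  have hφc := continuous_corr hx hφ
  have hφ0 : 0 ≤ φ 0 := (abs_nonneg _).trans (abs_corr_le hφ 0)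
  have hint : ∀ (ρ : Measure E) [IsFiniteMeasure ρ] (f : E → E), Continuous f →
      Integrable (fun w => φ (f w)) ρ := fun ρ _ f hf =>
    Integrable.of_bound (hφc.comp hf).aestronglyMeasurable (φ 0)
      (Filter.Eventually.of_forall fun w => abs_corr_le hφ _)
  have hint2 : ∀ f : E × E → E, Continuous f → Integrable (fun w => φ (f w)) (ν.prod ν) :=
    fun f hf => Integrable.of_bound (hφc.comp hf).aestronglyMeasurable (φ 0)
      (Filter.Eventually.of_forall fun w => abs_corr_le hφ _)
  set g : E → H := fun w => x (p - k • w) - x (-(k • w)) with hg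
  have hgi : Integrable g ν :=
    (integrable_orbit hx hφ ν (by fun_prop)).sub (integrable_orbit hx hφ ν (by fun_prop))
  set G : H := ∫ w, g w ∂ν with hG
  have hGx : ⟪x 0, G⟫ = ∫ w, φ (k • w - p) ∂ν - ∫ w, φ (k • w) ∂ν := by
    rw [hG, ← integral_inner hgi, ← integral_sub (hint ν _ (by fun_prop)) (hint ν _ (by fun_prop))]
    congr 1; ext w
    rw [hg]
    simp only [inner_sub_right, hφ, sub_zero]
    rw [corr_neg hφ, ← corr_neg hφ, neg_sub]
  have hgg : ∀ w w', ⟪g w', g w⟫ = 2 * φ (k • (w' - w)) - φ (k • (w' - w) - p)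
      - φ (k • (w' - w) + p) := by
    intro w w'
    have a1 : p - k • w - (p - k • w') = k • (w' - w) := by rw [smul_sub]; abel
    have a2 : p - k • w - -(k • w') = k • (w' - w) + p := by rw [smul_sub]; abel
    have a3 : -(k • w) - (p - k • w') = k • (w' - w) - p := by rw [smul_sub]; abel
    have a4 : -(k • w) - -(k • w') = k • (w' - w) := by rw [smul_sub]; abel
    rw [hg]
    simp only [inner_sub_right, inner_sub_left, hφ, a1, a2, a3, a4]
    ring
  set η := (ν.prod ν).map fun w : E × E => w.1 - w.2 with hη
  have : IsProbabilityMeasure η := Measure.isProbabilityMeasure_map (by fun_prop)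
  have hGG : ‖G‖ ^ 2 = 2 * ∫ z, φ (k • z) ∂η - ∫ z, φ (k • z - p) ∂η
      - ∫ z, φ (k • z + p) ∂η := by
    have hF : Integrable (fun w : E × E => 2 * φ (k • (w.1 - w.2)) - φ (k • (w.1 - w.2) - p)
      - φ (k • (w.1 - w.2) + p)) (ν.prod ν) :=
      (((hint2 _ (by fun_prop)).const_mul 2).sub (hint2 _ (by fun_prop))).sub
        (hint2 _ (by fun_prop))
    rw [← real_inner_self_eq_norm_sq]
    calc ⟪G, G⟫ = ∫ w', ∫ w, ⟪g w', g w⟫ ∂ν ∂ν := by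
          conv_lhs => rw [hG, real_inner_comm, ← integral_inner hgi]
          congr 1; ext w'
          rw [real_inner_comm, integral_inner hgi]
      _ = ∫ w, (2 * φ (k • (w.1 - w.2)) - φ (k • (w.1 - w.2) - p)
            - φ (k • (w.1 - w.2) + p)) ∂(ν.prod ν) := by
          simp_rw [hgg]
          exact (integral_prod _ hF).symm
      _ = ∫ z, (2 * φ (k • z) - φ (k • z - p) - φ (k • z + p)) ∂η := by
          rw [hη, integral_map (by fun_prop) (by fun_prop)]
      _ = _ := by
          have i1 := (hint η (fun z => k • z) (by fun_prop)).const_mul 2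
          have i2 := hint η (fun z => k • z - p) (by fun_prop)
          have i3 : Integrable (fun z => 2 * φ (k • z) - φ (k • z - p)) η := i1.sub i2
          rw [integral_sub i3 (hint η _ (by fun_prop)), integral_sub i1 i2, integral_const_mul]
  have hq : ‖k⁻¹ • p‖ ≤ δ := by
    rw [norm_smul, Real.norm_eq_abs, abs_of_pos (inv_pos.2 hk), inv_mul_le_iff₀ hk]
    linarith
  have key : ∀ s : E, ‖k⁻¹ • s‖ ≤ δ →
      |∫ z, φ (k • z + s) ∂η - ∫ z, φ (k • z) ∂η| ≤ φ 0 * ε := by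
    intro s hs
    have := hδ (k⁻¹ • s) hs (fun z => φ (k • z)) (by fun_prop) (φ 0) fun z => abs_corr_le hφ _
    simpa [smul_add, smul_smul, hk.ne'] using this
  have k1 := key p hq
  have k2 := key (-p) (by rwa [smul_neg, norm_neg])
  simp only [← sub_eq_add_neg] at k2
  have hGle : ‖G‖ ^ 2 ≤ φ 0 * (2 * ε) := by
    rw [hGG]; rw [abs_le] at k1 k2; linarith [k1.1, k2.1]
  rw [← hGx]
  calc |⟪x 0, G⟫| ≤ ‖x 0‖ * ‖G‖ := abs_real_inner_le_norm _ _
    _ ≤ √(φ 0) * √(φ 0 * (2 * ε)) := by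
        rw [norm_eq_sqrt_corr hφ]
        exact mul_le_mul_of_nonneg_left (Real.le_sqrt_of_sq_le hGle) (Real.sqrt_nonneg _)
    _ = φ 0 * √(2 * ε) := by
        rw [Real.sqrt_mul hφ0, ← mul_assoc, Real.mul_self_sqrt hφ0]

/-- The averages `v j = ∫ x (k j • u) dν(u)` over rapidly growing scales `k j` are almost
orthogonal when `φ` vanishes on the supports of the measures `k j • ν`: for `j < l` the product
`⟪v j, v l⟫` averages translates of `φ` by the short vectors `k j • u`, and without these
translations the average is zero. Comparing with a vector `e` that has the same product `m` with all
the `x (k j • u)` bounds `m` by Cauchy--Schwarz. -/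
theorem sq_card_mul_le_of_corr_eq_zero [CompleteSpace H] (hx : Continuous x)
    (hφ : ∀ y z, ⟪x y, x z⟫ = φ (z - y)) (ν : Measure E) [IsProbabilityMeasure ν]
    (hν : ∀ᵐ u ∂ν, ‖u‖ ≤ 1) {ε δ : ℝ}
    (hδ : ∀ q : E, ‖q‖ ≤ δ → ∀ ψ : E → ℝ, Continuous ψ → ∀ C : ℝ, (∀ z, |ψ z| ≤ C) →
      |∫ z, ψ (z + q) ∂((ν.prod ν).map fun w => w.1 - w.2)
        - ∫ z, ψ z ∂((ν.prod ν).map fun w => w.1 - w.2)| ≤ C * ε)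
    (k : ℕ → ℝ) (hk : ∀ j, 0 < k j) (hkδ : ∀ j l, j < l → k j ≤ δ * k l)
    (hz : ∀ j, ∀ᵐ u ∂ν, φ (k j • u) = 0) (N : ℕ) (e : H) (m : ℝ)
    (he : ∀ j < N, ∀ᵐ u ∂ν, ⟪e, x (k j • u)⟫ = m) :
    (N * m) ^ 2 ≤ ‖e‖ ^ 2 * (φ 0 * (N + N ^ 2 * √(2 * ε))) := by
  have hφ0 : 0 ≤ φ 0 := (abs_nonneg _).trans (abs_corr_le hφ 0)
  have hxi : ∀ j, Integrable (fun u => x (k j • u)) ν := fun j =>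
    integrable_orbit hx hφ ν (by fun_prop)
  set v : ℕ → H := fun j => ∫ u, x (k j • u) ∂ν with hv
  have hvi : ∀ j (y : E), ⟪x y, v j⟫ = ∫ w, φ (k j • w - y) ∂ν := fun j y => by
    rw [hv, ← integral_inner (hxi j)]
    simp only [hφ]
  have hlt : ∀ j l, j < l → ⟪v j, v l⟫ ≤ φ 0 * √(2 * ε) := by
    intro j l hjl
    rw [real_inner_comm]
    have hjint : v j = ∫ u, x (k j • u) ∂ν := rfl
    rw [hjint, ← integral_inner (hxi j)]
    have hb : ∀ᵐ u ∂ν, ‖⟪v l, x (k j • u)⟫‖ ≤ φ 0 * √(2 * ε) := by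
      filter_upwards [hν] with u hu
      have hp : ‖k j • u‖ ≤ δ * k l := by
        rw [norm_smul, Real.norm_eq_abs, abs_of_pos (hk j)]
        exact (mul_le_of_le_one_right (hk j).le hu).trans (hkδ j l hjl)
      have := abs_integral_corr_translate_le hx hφ ν hδ (hk l) hp
      rwa [integral_eq_zero_of_ae (hz l), sub_zero, ← hvi, real_inner_comm] at this
    have := norm_integral_le_of_norm_le_const hb
    rw [probReal_univ, mul_one] at this
    exact (le_abs_self _).trans this
  have hself : ∀ j, ⟪v j, v j⟫ ≤ φ 0 := by
    intro j
    have : ‖v j‖ ≤ √(φ 0) := by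
      have := norm_integral_le_of_norm_le_const (μ := ν) (f := fun u => x (k j • u))
        (Filter.Eventually.of_forall fun u => (norm_eq_sqrt_corr hφ _).le)
      rwa [probReal_univ, mul_one] at this
    rw [real_inner_self_eq_norm_sq]
    calc ‖v j‖ ^ 2 ≤ √(φ 0) ^ 2 := by gcongr
      _ = φ 0 := Real.sq_sqrt hφ0
  have hs : 0 ≤ φ 0 * √(2 * ε) := by positivity
  have hpair : ∀ j l, ⟪v j, v l⟫ ≤ (if j = l then φ 0 else 0) + φ 0 * √(2 * ε) := by
    intro j l
    rcases lt_trichotomy j l with h | h | h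
    · rw [if_neg h.ne, zero_add]; exact hlt j l h
    · rw [if_pos h, h]; linarith [hself l]
    · rw [if_neg h.ne', zero_add, real_inner_comm]; exact hlt l j h
  have hnorm : ‖∑ j ∈ Finset.range N, v j‖ ^ 2 ≤ φ 0 * (N + N ^ 2 * √(2 * ε)) := by
    rw [← real_inner_self_eq_norm_sq, sum_inner]
    simp only [inner_sum]
    calc ∑ j ∈ Finset.range N, ∑ l ∈ Finset.range N, ⟪v j, v l⟫
        ≤ ∑ j ∈ Finset.range N, ∑ l ∈ Finset.range N,
          ((if j = l then φ 0 else 0) + φ 0 * √(2 * ε)) :=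
          Finset.sum_le_sum fun j _ => Finset.sum_le_sum fun l _ => hpair j l
      _ = ∑ j ∈ Finset.range N, (φ 0 + N * (φ 0 * √(2 * ε))) := by
          refine Finset.sum_congr rfl fun j hj => ?_
          rw [Finset.sum_add_distrib, Finset.sum_ite_eq, if_pos hj]
          simp
      _ = φ 0 * (N + N ^ 2 * √(2 * ε)) := by simp; ring
  have hprod : ⟪e, ∑ j ∈ Finset.range N, v j⟫ = N * m := by
    rw [inner_sum]
    have : ∀ j ∈ Finset.range N, ⟪e, v j⟫ = m := by
      intro j hj
      rw [hv]
      simp only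
      rw [← integral_inner (hxi j), integral_congr_ae (he j (Finset.mem_range.1 hj))]
      simp
    rw [Finset.sum_congr rfl this]; simp
  calc (N * m) ^ 2 = |⟪e, ∑ j ∈ Finset.range N, v j⟫| ^ 2 := by rw [sq_abs, hprod]
    _ ≤ (‖e‖ * ‖∑ j ∈ Finset.range N, v j‖) ^ 2 := by
        gcongr; exact abs_real_inner_le_norm _ _
    _ = ‖e‖ ^ 2 * ‖∑ j ∈ Finset.range N, v j‖ ^ 2 := by ring
    _ ≤ _ := by gcongr

end Hilbert

/-! ### Translates of an indicator function -/

section Translates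

open scoped RealInnerProductSpace

variable {E : Type*} [NormedAddCommGroup E] [MeasurableSpace E] [BorelSpace E] (μ : Measure E)
  [μ.IsAddHaarMeasure] {S : Set E}

/-- The indicator function of the translate `S - y`, as an element of `L²`. -/
noncomputable def indicatorTranslate (hS : MeasurableSet S) (hμS : μ S ≠ ⊤) (y : E) : Lp ℝ 2 μ :=
  Lp.compMeasurePreserving (fun z => z + y) (measurePreserving_add_right μ y)
    (indicatorConstLp 2 hS hμS (1 : ℝ))

theorem continuous_indicatorTranslate [NormedSpace ℝ E] [FiniteDimensional ℝ E]
    (hS : MeasurableSet S) (hμS : μ S ≠ ⊤) :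
    Continuous (indicatorTranslate μ hS hμS) := by
  let g : E → C(E, E) := fun y => ⟨fun z => z + y, by fun_prop⟩
  have hg : Continuous g := ContinuousMap.continuous_of_continuous_uncurry _ (by
    show Continuous fun p : E × E => p.2 + p.1
    fun_prop)
  exact Continuous.compMeasurePreservingLp (g := g) continuous_const hg
    (measurePreserving_add_right μ) (by simp)

theorem inner_indicatorConstLp_indicatorTranslate (hS : MeasurableSet S) (hμS : μ S ≠ ⊤)
    {W : Set E} (hW : MeasurableSet W) (hμW : μ W ≠ ⊤) (y : E) :
    ⟪indicatorConstLp 2 hW hμW (1 : ℝ), indicatorTranslate μ hS hμS y⟫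
      = μ.real (W ∩ (fun z => z + y) ⁻¹' S) := by
  rw [indicatorTranslate, Lp.indicatorConstLp_compMeasurePreserving,
    L2.real_inner_indicatorConstLp_one_indicatorConstLp_one _ _ _ (by simpa using hμS)]

theorem inner_indicatorTranslate (hS : MeasurableSet S) (hμS : μ S ≠ ⊤) (y z : E) :
    ⟪indicatorTranslate μ hS hμS y, indicatorTranslate μ hS hμS z⟫
      = μ.real (S ∩ (fun w => w + (z - y)) ⁻¹' S) := by
  conv_lhs => rw [indicatorTranslate, Lp.indicatorConstLp_compMeasurePreserving]
  rw [inner_indicatorConstLp_indicatorTranslate]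
  have : (fun w => w + y) ⁻¹' S ∩ (fun w => w + z) ⁻¹' S
      = (fun w => w + y) ⁻¹' (S ∩ (fun w => w + (z - y)) ⁻¹' S) := by
    ext w; simp
  rw [this]
  rw [measureReal_def, measure_preimage_add_right, measureReal_def]

end Translates

/-! ### Finite measurable covers -/

section Coloring

variable {E : Type*} [NormedAddCommGroup E] [NormedSpace ℝ E] [FiniteDimensional ℝ E]
  [MeasurableSpace E] [BorelSpace E]

/-- If finitely many measurable sets cover the space, one of them occupies a definite proportion of
a large ball, and its translates along the sets `k • supp ν`, with `k` odd, cannot all avoid it. The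
scales are powers of an odd number `M`; the ball is so large that the translates used stay within
the ball of twice the radius. -/
theorem exists_odd_not_ae_disjoint_translate (μ : Measure E) [μ.IsAddHaarMeasure]
    (ν : Measure E) [IsProbabilityMeasure ν] (hν : ∀ᵐ u ∂ν, ‖u‖ ≤ 1)
    (hac : ((ν.prod ν).map fun w => w.1 - w.2) ≪ μ) {n : ℕ} (A : Fin n → Set E)
    (hA : ∀ c, NullMeasurableSet (A c) μ) (hcov : ∀ y, ∃ c, y ∈ A c) :
    ∃ c, ∃ k : ℕ, Odd k ∧ ¬ ∀ᵐ u ∂ν, Disjoint (A c) ((fun z => z + (k : ℝ) • u) ⁻¹' A c) := by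
  by_contra! hdis
  -- Borel sets `B c ⊇ A c` still cover, and their intersections with translates are null.
  choose B hAB hB hBA using fun c => (hA c).exists_measurable_superset_ae_eq
  have hBdis : ∀ c (k : ℕ), Odd k → ∀ᵐ u ∂ν,
      μ (B c ∩ (fun z => z + (k : ℝ) • u) ⁻¹' B c) = 0 := by
    intro c k hk
    filter_upwards [hdis c k hk] with u hu
    have h1 : (B c ∩ (fun z => z + (k : ℝ) • u) ⁻¹' B c : Set E) =ᵐ[μ]
        (A c ∩ (fun z => z + (k : ℝ) • u) ⁻¹' A c : Set E) :=
      (hBA c).inter ((measurePreserving_add_right μ _).quasiMeasurePreserving.preimage_ae_eq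
        (hBA c))
    rw [measure_congr h1, hu.inter_eq, measure_empty]
  have hn : 0 < n := by
    obtain ⟨c, -⟩ := hcov 0
    exact c.pos
  -- The constants are chosen so that `(4 * D) ^ 2 ≤ 8 * D ^ 2` is the final contradiction.
  set D : ℕ := 2 ^ Module.finrank ℝ E * n with hD
  have hDpos : 0 < D := by positivity
  have hDR : (0 : ℝ) < D := by exact_mod_cast hDpos
  obtain ⟨δ, hδ, hTV⟩ := by
    have : IsProbabilityMeasure ((ν.prod ν).map fun w : E × E => w.1 - w.2) :=
      Measure.isProbabilityMeasure_map (by fun_prop)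
    exact exists_abs_integral_translate_sub_le μ _ hac
      (show 0 < 1 / (32 * (D : ℝ) ^ 2) by positivity)
  obtain ⟨a, ha⟩ := exists_nat_gt (1 / δ)
  -- With `δ * M ≥ 1`, each scale `M ^ j` is at most `δ` times every larger one.
  set M : ℕ := 2 * a + 1 with hM
  have hModd : Odd M := ⟨a, rfl⟩
  have hM1 : (1 : ℝ) ≤ M := by rw [hM]; push_cast; linarith [(Nat.cast_nonneg a : (0 : ℝ) ≤ a)]
  have hMδ : 1 ≤ δ * M := by
    rw [div_lt_iff₀ hδ] at ha
    have : (0 : ℝ) ≤ a := Nat.cast_nonneg a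
    rw [hM]; push_cast; nlinarith
  set N : ℕ := 4 * D with hN
  set R : ℝ := (M : ℝ) ^ N
  have hRpos : 0 < R := by positivity
  have hBR : μ (Metric.ball 0 R) ≠ ⊤ := measure_ball_lt_top.ne
  have hSfin : ∀ c, μ (B c ∩ Metric.ball 0 R) ≠ ⊤ := fun c =>
    measure_ne_top_of_subset Set.inter_subset_right hBR
  obtain ⟨c, hc⟩ : ∃ c, μ.real (Metric.ball 0 R) ≤ n * μ.real (B c ∩ Metric.ball 0 R) := by
    by_contra! hlt
    have h1 : μ.real (Metric.ball 0 R) ≤ ∑ c, μ.real (B c ∩ Metric.ball 0 R) := by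
      calc μ.real (Metric.ball 0 R) ≤ μ.real (⋃ c, B c ∩ Metric.ball 0 R) := by
            refine measureReal_mono (fun y hy => ?_) ?_
            · obtain ⟨c, hc⟩ := hcov y
              exact Set.mem_iUnion.2 ⟨c, hAB c hc, hy⟩
            · exact measure_ne_top_of_subset
                (Set.iUnion_subset fun c => Set.inter_subset_right) hBR
        _ ≤ _ := measureReal_iUnion_fintype_le _
    have : Nonempty (Fin n) := ⟨⟨0, hn⟩⟩
    have h2 : ∑ c, n * μ.real (B c ∩ Metric.ball 0 R) < ∑ _c : Fin n, μ.real (Metric.ball 0 R) :=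
      Finset.sum_lt_sum_of_nonempty Finset.univ_nonempty fun c _ => hlt c
    rw [← Finset.mul_sum, Finset.sum_const, Finset.card_univ, Fintype.card_fin,
      nsmul_eq_mul] at h2
    exact absurd h2 (not_lt.2 (mul_le_mul_of_nonneg_left h1 (Nat.cast_nonneg n)))
  set S := B c ∩ Metric.ball 0 R
  have hSm : MeasurableSet S := (hB c).inter measurableSet_ball
  have hWR : μ (Metric.ball (0 : E) (2 * R)) ≠ ⊤ := measure_ball_lt_top.ne
  have hW : μ.real (Metric.ball (0 : E) (2 * R))
      = 2 ^ Module.finrank ℝ E * μ.real (Metric.ball 0 R) := by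
    rw [measureReal_def, Measure.addHaar_ball_mul_of_pos μ 0 two_pos, ENNReal.toReal_mul,
      ENNReal.toReal_ofReal (by positivity), measureReal_def]
  set m := μ.real S with hm
  have hφ0 : μ.real (S ∩ (fun w => w + (0 : E)) ⁻¹' S) = m := by simp [hm]
  have hmain := sq_card_mul_le_of_corr_eq_zero
    (φ := fun z => μ.real (S ∩ (fun w => w + z) ⁻¹' S))
    (continuous_indicatorTranslate μ hSm (hSfin c))
    (inner_indicatorTranslate μ hSm (hSfin c)) ν hν hTV (fun j => (M : ℝ) ^ j)
    (fun j => by positivity) (fun j l hjl => ?_) (fun j => ?_) N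
    (indicatorConstLp 2 (measurableSet_ball (x := (0 : E)) (ε := 2 * R)) hWR (1 : ℝ)) m
    (fun j hj => ?_)
  · rw [← real_inner_self_eq_norm_sq, L2.real_inner_indicatorConstLp_one_indicatorConstLp_one,
      Set.inter_self, hW, hφ0] at hmain
    have hsqrt : √(2 * (1 / (32 * (D : ℝ) ^ 2))) = 1 / (4 * D) := by
      rw [show 2 * (1 / (32 * (D : ℝ) ^ 2)) = (1 / (4 * D)) ^ 2 by field_simp; norm_num,
        Real.sqrt_sq (by positivity)]
    have hball : 0 < μ.real (Metric.ball (0 : E) R) :=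
      ENNReal.toReal_pos (Metric.measure_ball_pos μ 0 hRpos).ne' hBR
    have hmpos : 0 < m := by
      rcases (measureReal_nonneg : 0 ≤ m).eq_or_lt with h | h
      · have : (n : ℝ) * m = 0 := by rw [← hm] at h; rw [← h, mul_zero]
        linarith
      · exact h
    have hVm : 2 ^ Module.finrank ℝ E * μ.real (Metric.ball (0 : E) R) ≤ D * m := by
      rw [hD]; push_cast
      rw [mul_assoc]
      gcongr
    have hfac : (N : ℝ) + N ^ 2 * (1 / (4 * D)) = 8 * D := by
      rw [hN]; push_cast; field_simp; norm_num
    rw [hsqrt, hfac] at hmain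
    have : (N * m) ^ 2 ≤ D * m * (m * (8 * D)) :=
      hmain.trans (mul_le_mul_of_nonneg_right hVm (by positivity))
    rw [hN] at this
    push_cast at this
    nlinarith [mul_pos (mul_pos hDR hmpos) (mul_pos hDR hmpos)]
  · obtain ⟨d, rfl⟩ := Nat.exists_eq_add_of_lt hjl
    have h1 : (1 : ℝ) ≤ M ^ d := one_le_pow₀ hM1
    have h2 : (0 : ℝ) < M ^ j := by positivity
    calc (M : ℝ) ^ j ≤ M ^ j * ((δ * M) * M ^ d) :=
          le_mul_of_one_le_right h2.le (one_le_mul_of_one_le_of_one_le hMδ h1)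
      _ = δ * M ^ (j + d + 1) := by ring
  · filter_upwards [hBdis c (M ^ j) hModd.pow] with u hu
    push_cast at hu
    rw [measureReal_def, measure_mono_null _ hu, ENNReal.toReal_zero]
    exact Set.inter_subset_inter Set.inter_subset_left
      (Set.preimage_mono Set.inter_subset_left)
  · filter_upwards [hν] with u hu
    rw [inner_indicatorConstLp_indicatorTranslate, Set.inter_eq_right.2,
      measureReal_def, measure_preimage_add_right, hm, measureReal_def]
    intro z hz
    have hz' : ‖z + (M : ℝ) ^ j • u‖ < R := by simpa using hz.2
    have hu' : ‖(M : ℝ) ^ j • u‖ ≤ R := by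
      rw [norm_smul, norm_pow, Real.norm_natCast]
      exact (mul_le_of_le_one_right (by positivity) hu).trans (pow_le_pow_right₀ hM1 hj.le)
    rw [mem_ball_zero_iff]
    calc ‖z‖ = ‖z + (M : ℝ) ^ j • u - (M : ℝ) ^ j • u‖ := by rw [add_sub_cancel_right]
      _ ≤ ‖z + (M : ℝ) ^ j • u‖ + ‖(M : ℝ) ^ j • u‖ := norm_sub_le _ _
      _ < 2 * R := by linarith

end Coloring

/-! ### Chords of a circular arc -/

section Chord

/-- The law of the point `(cos θ, sin θ)` for `θ` uniform in `(0, 1)`. On so short an arc a chord,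
as a vector, determines its two end points. The plane is `ℝ × ℝ` here; its maximum norm plays no
role. -/
noncomputable def arcMeasure : Measure (ℝ × ℝ) :=
  (volume.restrict (Set.Ioo (0 : ℝ) 1)).map fun θ => (Real.cos θ, Real.sin θ)

instance : IsProbabilityMeasure arcMeasure := by
  have : IsProbabilityMeasure (volume.restrict (Set.Ioo (0 : ℝ) 1)) := ⟨by simp⟩
  exact Measure.isProbabilityMeasure_map (by fun_prop)

theorem ae_arcMeasure : ∀ᵐ u ∂arcMeasure, u.1 ^ 2 + u.2 ^ 2 = 1 := by
  rw [arcMeasure, ae_map_iff (by fun_prop)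
    (measurableSet_eq_fun (by fun_prop) (by fun_prop))]
  exact Filter.Eventually.of_forall fun θ => Real.cos_sq_add_sin_sq θ

/-- The chord vector between the points of the unit circle at the angles `p.1` and `p.2`. -/
noncomputable def chord (p : ℝ × ℝ) : ℝ × ℝ :=
  (Real.cos p.1 - Real.cos p.2, Real.sin p.1 - Real.sin p.2)

@[fun_prop]
theorem continuous_chord : Continuous chord := by unfold chord; fun_prop

/-- The derivative of `chord`. -/
noncomputable def fderivChord (p : ℝ × ℝ) : ℝ × ℝ →L[ℝ] ℝ × ℝ :=
  (Matrix.toLin (.finTwoProd ℝ) (.finTwoProd ℝ)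
    !![-Real.sin p.1, Real.sin p.2; Real.cos p.1, -Real.cos p.2]).toContinuousLinearMap

theorem hasFDerivAt_chord (p : ℝ × ℝ) : HasFDerivAt chord (fderivChord p) p := by
  unfold fderivChord
  rw [Matrix.toLin_finTwoProd_toContinuousLinearMap]
  convert!
    HasFDerivAt.prodMk (𝕜 := ℝ)
      (((Real.hasDerivAt_cos p.1).comp_hasFDerivAt p hasFDerivAt_fst).sub
        ((Real.hasDerivAt_cos p.2).comp_hasFDerivAt p hasFDerivAt_snd))
      (((Real.hasDerivAt_sin p.1).comp_hasFDerivAt p hasFDerivAt_fst).sub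
        ((Real.hasDerivAt_sin p.2).comp_hasFDerivAt p hasFDerivAt_snd)) using 2 <;>
  simp [sub_eq_add_neg, neg_smul (_ : ℝ) (_ : ℝ × ℝ →L[ℝ] ℝ)]

theorem det_fderivChord (p : ℝ × ℝ) : (fderivChord p).det = Real.sin (p.1 - p.2) := by
  unfold fderivChord
  simp only [LinearMap.det_toContinuousLinearMap, LinearMap.det_toLin,
    Matrix.det_fin_two_of, Real.sin_sub]
  ring

/-- Chords of the circle inside the open first quadrant are determined by their vectors. A nonzero
chord vector has coordinates of opposite signs. If two chords have the same vector, the second is a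
translate of the first along its normal, by a vector whose coordinates therefore do not have
opposite signs; but this vector joins two points of the arc, so it is zero. -/
theorem eq_of_chord_eq {a b c d a' b' c' d' : ℝ} (ha : 0 < a) (hb : 0 < b) (hc : 0 < c)
    (hd : 0 < d) (ha' : 0 < a') (hb' : 0 < b') (h1 : a ^ 2 + b ^ 2 = 1) (h2 : c ^ 2 + d ^ 2 = 1)
    (h3 : a' ^ 2 + b' ^ 2 = 1) (h4 : c' ^ 2 + d' ^ 2 = 1) (hx : a - c = a' - c')
    (hy : b - d = b' - d') (hne : a ≠ c) : a = a' := by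
  obtain ⟨v, rfl⟩ : ∃ v, c = a - v := ⟨a - c, by ring⟩
  obtain ⟨w, rfl⟩ : ∃ w, d = b - w := ⟨b - d, by ring⟩
  obtain ⟨x, rfl⟩ : ∃ x, a' = a + x := ⟨a' - a, by ring⟩
  obtain ⟨y, rfl⟩ : ∃ y, b' = b + y := ⟨b' - b, by ring⟩
  obtain rfl : c' = a + x - v := by linarith
  obtain rfl : d' = b + y - w := by linarith
  have hv : v ≠ 0 := fun h => hne (by rw [h, sub_zero])
  have hvw : v * (a + (a - v)) = -(w * (b + (b - w))) := by linarith
  have horth : v * x = -(w * y) := by linarith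
  have hchord : x * (a + (a + x)) = -(y * (b + (b + y))) := by linarith
  have hneg : v * w < 0 := by
    have hv2 : 0 < v ^ 2 := by positivity
    have : v ^ 2 * (a + (a - v)) = -(v * w * (b + (b - w))) := by linear_combination v * hvw
    by_contra! h
    nlinarith [mul_pos hv2 (add_pos ha hc), mul_nonneg h (add_pos hb hd).le]
  have hy0 : y = 0 := by
    by_contra hy0
    have e : y * (v * w * (a + (a + x)) - v ^ 2 * (b + (b + y))) = 0 := by
      linear_combination (-v ^ 2) * hchord + v * (a + (a + x)) * horth
    have e' := (mul_eq_zero.1 e).resolve_left hy0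
    have hv2 : 0 < v ^ 2 := by positivity
    nlinarith [mul_pos hv2 (add_pos hb hb'), mul_pos (neg_pos.2 hneg) (add_pos ha ha')]
  rw [hy0, mul_zero, neg_zero] at horth
  rw [(mul_eq_zero.1 horth).resolve_left hv, add_zero]

theorem injOn_chord :
    Set.InjOn chord ((Set.Ioo (0 : ℝ) 1 ×ˢ Set.Ioo (0 : ℝ) 1) ∩ {p | p.1 ≠ p.2}) := by
  have hcos : ∀ s ∈ Set.Ioo (0 : ℝ) 1, 0 < Real.cos s := fun s hs =>
    Real.cos_pos_of_mem_Ioo ⟨by linarith [hs.1, Real.pi_pos], by linarith [hs.2, Real.pi_gt_three]⟩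
  have hsin : ∀ s ∈ Set.Ioo (0 : ℝ) 1, 0 < Real.sin s := fun s hs =>
    Real.sin_pos_of_pos_of_lt_pi hs.1 (by linarith [hs.2, Real.pi_gt_three])
  have hinj : ∀ s ∈ Set.Ioo (0 : ℝ) 1, ∀ t ∈ Set.Ioo (0 : ℝ) 1, Real.cos s = Real.cos t → s = t :=
    fun s hs t ht => fun h => Real.injOn_cos ⟨hs.1.le, by linarith [hs.2, Real.pi_gt_three]⟩
      ⟨ht.1.le, by linarith [ht.2, Real.pi_gt_three]⟩ h
  rintro ⟨s, t⟩ ⟨⟨hs, ht⟩, hst⟩ ⟨s', t'⟩ ⟨⟨hs', ht'⟩, -⟩ h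
  simp only [chord, Prod.mk.injEq] at h
  simp only at hs ht hs' ht'
  have hc : Real.cos s = Real.cos s' :=
    eq_of_chord_eq (hcos s hs) (hsin s hs) (hcos t ht) (hsin t ht) (hcos s' hs') (hsin s' hs')
      (Real.cos_sq_add_sin_sq s) (Real.cos_sq_add_sin_sq t) (Real.cos_sq_add_sin_sq s')
      (Real.cos_sq_add_sin_sq t') h.1 h.2 fun h => hst (hinj s hs t ht h)
  have hc' : Real.cos t = Real.cos t' := by linarith [h.1]
  rw [hinj s hs s' hs' hc, hinj t ht t' ht' hc']

theorem volume_diagonal_eq_zero : volume {p : ℝ × ℝ | p.1 = p.2} = 0 := by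
  have h := Measure.addHaar_submodule (volume : Measure (ℝ × ℝ))
    (LinearMap.ker (LinearMap.fst ℝ ℝ ℝ - LinearMap.snd ℝ ℝ ℝ)) (by
      rw [Ne, LinearMap.ker_eq_top]
      intro h
      have := congrArg (fun f => f ((1, 0) : ℝ × ℝ)) h
      simp at this)
  convert! h using 2
  ext p
  simp [sub_eq_zero]

/-- The difference of two independent random points of the arc has an absolutely continuous law:
`chord` is injective with nonzero Jacobian off the diagonal. -/
theorem map_sub_arcMeasure_absolutelyContinuous :
    ((arcMeasure.prod arcMeasure).map fun w => w.1 - w.2) ≪ volume := by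
  have hlaw : ((arcMeasure.prod arcMeasure).map fun w => w.1 - w.2)
      = (volume.restrict (Set.Ioo (0 : ℝ) 1 ×ˢ Set.Ioo (0 : ℝ) 1)).map chord := by
    rw [arcMeasure, Measure.map_prod_map _ _ (by fun_prop) (by fun_prop),
      Measure.map_map (by fun_prop) (by fun_prop), Measure.prod_restrict,
      ← Measure.volume_eq_prod]
    rfl
  rw [hlaw]
  refine Measure.AbsolutelyContinuous.mk fun Z hZ hZ0 => ?_
  have hm : MeasurableSet (chord ⁻¹' Z) := continuous_chord.measurable hZ
  rw [Measure.map_apply (by fun_prop) hZ, Measure.restrict_apply hm]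
  set T := (chord ⁻¹' Z) ∩ ((Set.Ioo (0 : ℝ) 1 ×ˢ Set.Ioo (0 : ℝ) 1) ∩ {p | p.1 ≠ p.2})
  have hTm : MeasurableSet T := hm.inter ((measurableSet_Ioo.prod measurableSet_Ioo).inter
    (measurableSet_eq_fun measurable_fst measurable_snd).compl)
  have hT0 : volume T = 0 := by
    have h1 := lintegral_abs_det_fderiv_eq_addHaar_image volume hTm
      (fun p _ => (hasFDerivAt_chord p).hasFDerivWithinAt)
      (injOn_chord.mono Set.inter_subset_right)
    rw [measure_mono_null (Set.image_subset_iff.2 Set.inter_subset_left) hZ0] at h1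
    simp_rw [det_fderivChord] at h1
    rw [lintegral_eq_zero_iff (by fun_prop), Filter.EventuallyEq, ae_restrict_iff' hTm] at h1
    rw [measure_eq_zero_iff_ae_notMem]
    filter_upwards [h1] with p hp hpT
    have h2 := hp hpT
    obtain ⟨-, ⟨hs, ht⟩, hst⟩ := hpT
    simp only [Pi.zero_apply, ENNReal.ofReal_eq_zero] at h2
    have h3 := abs_eq_zero.1 (le_antisymm h2 (abs_nonneg _))
    rw [Real.sin_eq_zero_iff_of_lt_of_lt (by linarith [hs.1, ht.2, Real.pi_gt_three])
      (by linarith [hs.2, ht.1, Real.pi_gt_three])] at h3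
    exact hst (sub_eq_zero.1 h3)
  refine measure_mono_null (fun p hp => ?_) (measure_union_null hT0 volume_diagonal_eq_zero)
  by_cases h : p.1 = p.2
  · exact Or.inr h
  · exact Or.inl ⟨hp.1, hp.2, h⟩

end Chord

/-! ### The odd-distance graph -/

section Plane

/-- The identification of `ℝ × ℝ` with the Euclidean plane. -/
noncomputable def toPlane (p : ℝ × ℝ) : EuclideanSpace ℝ (Fin 2) := !₂[p.1, p.2]

theorem measurePreserving_toPlane : MeasurePreserving toPlane volume volume := by
  have h : toPlane = WithLp.toLp 2 ∘ MeasurableEquiv.finTwoArrow.symm := by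
    funext p
    ext i
    fin_cases i <;> rfl
  rw [h]
  exact (PiLp.volume_preserving_toLp (Fin 2)).comp (volume_preserving_finTwoArrow ℝ).symm

theorem dist_toPlane_add_smul (p u : ℝ × ℝ) (hu : u.1 ^ 2 + u.2 ^ 2 = 1) {k : ℝ} (hk : 0 ≤ k) :
    dist (toPlane p) (toPlane (p + k • u)) = k := by
  rw [EuclideanSpace.dist_eq, Fin.sum_univ_two, Real.sqrt_eq_iff_eq_sq (by positivity) hk]
  simp only [toPlane, Real.dist_eq, sq_abs]
  simp
  linear_combination k ^ 2 * hu

end Plane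

theorem not_measurablyColorable_oddDistanceGraph (n : ℕ) :
    ¬ MeasurablyColorable (volume : Measure (EuclideanSpace ℝ (Fin 2))) oddDistanceGraph n := by
  rintro ⟨C, hC⟩
  have hnorm : ∀ᵐ u ∂arcMeasure, ‖u‖ ≤ 1 := by
    filter_upwards [ae_arcMeasure] with u hu
    rw [Prod.norm_def, Real.norm_eq_abs, Real.norm_eq_abs]
    exact max_le (abs_le_one_iff_mul_self_le_one.2 (by nlinarith))
      (abs_le_one_iff_mul_self_le_one.2 (by nlinarith))
  obtain ⟨c, k, hk, hdis⟩ := exists_odd_not_ae_disjoint_translate (volume : Measure (ℝ × ℝ))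
    arcMeasure hnorm map_sub_arcMeasure_absolutelyContinuous
    (fun c : Fin n => toPlane ⁻¹' C.colorClass c)
    (fun c => (hC c).preimage measurePreserving_toPlane.quasiMeasurePreserving)
    (fun y => ⟨C (toPlane y), C.mem_colorClass _⟩)
  refine hdis ?_
  filter_upwards [ae_arcMeasure] with u hu
  refine Set.disjoint_left.2 fun p hp hp' => ?_
  have hadj : oddDistanceGraph.Adj (toPlane p) (toPlane (p + (k : ℝ) • u)) :=
    ⟨k, by exact_mod_cast hk, by rw [dist_toPlane_add_smul p u hu (Nat.cast_nonneg k)]; simp⟩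
  exact C.valid hadj (Eq.trans hp (Eq.symm hp'))

/-- The measurable chromatic number of the odd-distance graph is infinite. -/
theorem mainTheorem1 :
    measurableChromaticNumber (volume : Measure (EuclideanSpace ℝ (Fin 2))) oddDistanceGraph = ⊤ := by
  rw [measurableChromaticNumber]
  simp [not_measurablyColorable_oddDistanceGraph]
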